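/- For an integer $n\ge 0$, let $Q_n$ be the $n$-dimensional hypercube: the graph whose vertices are the binary strings of length $n$, two strings being adjacent if and only if they differ in exactly one position (so $Q_0=K_1$). For a connected graph $G$ and a graph $W$, the $W$-structure connectivity $\kappa(G;W)$ is the least cardinality of a set of pairwise vertex-disjoint subgraphs of $G$, each isomorphic to $W$, such that deleting all their vertices from $G$ leaves a disconnected graph. The $W$-structure fault diameter $D_f(G;W)$ is the maximum diameter of a graph obtained from $G$ by deleting all vertices of at most $\kappa(G;W)-1$ pairwise vertex-disjoint subgraphs of $G$, each isomorphic to $W$; here the diameter of a graph is the maximum distance between two of its vertices. Theorem. Let $n\ge 3$ and $0\le m\le n-2$ be integers. Then $$D_f(Q_n;Q_m)=\begin{cases} n & \text{if } n=m+2,\\ n+1 & \text{if } n\ge m+3.\end{cases}$$ -/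

import Mathlib

namespace StructureFault

/-- The `n`-dimensional hypercube `Q_n`: the vertices are the binary strings of length `n`, and two
strings are adjacent iff they differ in exactly one position. -/
def hypercube (n : ℕ) : SimpleGraph (Fin n → Bool) where
  Adj x y := hammingDist x y = 1
  symm := ⟨fun x y h => by rw [hammingDist_comm]; exact h⟩
  loopless := ⟨fun x h => by simp at h⟩

variable {V U : Type*}

/-- `F` is a finite set of pairwise vertex-disjoint subgraphs of `G`, each of which (as a graph on
its own vertex set, not necessarily induced in `G`) is isomorphic to `W`. -/
def IsStructureFamily (G : SimpleGraph V) (W : SimpleGraph U) (F : Finset G.Subgraph) : Prop :=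
  (∀ H ∈ F, Nonempty (H.coe ≃g W)) ∧
    ∀ H ∈ F, ∀ K ∈ F, H ≠ K → Disjoint H.verts K.verts

/-- The graph that remains of `G` when all vertices of the members of `F` are deleted. -/
def remove (G : SimpleGraph V) (F : Finset G.Subgraph) :
    SimpleGraph {v : V | ∀ H ∈ F, v ∉ H.verts} :=
  G.induce {v : V | ∀ H ∈ F, v ∉ H.verts}

/-- The `W`-structure connectivity `κ(G; W)`: the least number of members of a set of pairwise
vertex-disjoint subgraphs isomorphic to `W` whose removal leaves a disconnected graph, i.e. one in
which some two remaining vertices are not joined by a path (`⊤` if there is no such set). -/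
noncomputable def structureConnectivity (G : SimpleGraph V) (W : SimpleGraph U) : ℕ∞ :=
  ⨅ (F : Finset G.Subgraph) (_ : IsStructureFamily G W F ∧ ¬ (remove G F).Preconnected),
    (F.card : ℕ∞)

/-- The `W`-structure fault diameter `D_f(G; W)`: the largest diameter of a graph obtained from `G`
by removing at most `κ(G; W) - 1` pairwise vertex-disjoint subgraphs isomorphic to `W`. Diameters
are `ℕ∞`-valued, so that a disconnected graph has diameter `⊤` and a finite value of the supremum
is a maximum. -/
noncomputable def structureFaultDiameter (G : SimpleGraph V) (W : SimpleGraph U) : ℕ∞ :=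
  ⨆ (F : Finset G.Subgraph)
    (_ : IsStructureFamily G W F ∧ (F.card : ℕ∞) + 1 ≤ structureConnectivity G W),
    (remove G F).ediam

end StructureFault

namespace StructureFault

/-! A copy of $Q_m$ in $Q_n$ occupies a subcube with at most $m$ free positions, so removing fewer
than $n-m$ copies deletes fewer subcubes than there are positions at which each of them is fixed.
This inequality, not disjointness, drives the upper bound. It survives passing to a half-cube that
misses one of the subcubes: their number drops, and each remaining one loses at most one fixed
position.

Under this inequality two strings that are opposite on all free positions stay joined by a geodesic
(`joinedWithin_of_antipodal`). If $u,v$ differ on $D$ and agree on $S$, one flips a suitable set $T$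
of about half of $S$, crosses $D$ geodesically and flips $T$ back, in at most $n+1$ steps
(`joinedWithin_of_card_lt`). Finite distances also give connectivity at least $n-m$; removing all
$n-m$ neighbours of an $m$-subcube isolates it and gives equality.

Leaving one neighbour, in direction $j$, forces a detour through $j$: some string at distance $n-1$
moves to distance at least $n+1$ (`hammingDist_add_two_le_length`). That string survives when $n\ge
m+3$. If $n=m+2$, at most one subcube is removed, which keeps all distances at most $n$
(`joinedWithin_of_card_le_one`), and the empty family attains $n$. -/

/-- The vertex obtained from `x` by changing position `i`. -/
def toggle {n : ℕ} (x : Fin n → Bool) (i : Fin n) : Fin n → Bool :=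
  Function.update x i (!x i)

/-! ### Single-coordinate changes. -/

section Toggle

variable {n : ℕ}

@[simp] theorem toggle_same (x : Fin n → Bool) (i : Fin n) : toggle x i i = !x i := by
  simp [toggle]

theorem toggle_of_ne (x : Fin n → Bool) {i j : Fin n} (h : j ≠ i) : toggle x i j = x j := by
  simp [toggle, h]

@[simp] theorem toggle_toggle (x : Fin n → Bool) (i : Fin n) : toggle (toggle x i) i = x := by
  funext j
  by_cases h : j = i
  · subst h; simp
  · simp [toggle_of_ne _ h]

theorem toggle_comm (x : Fin n → Bool) (i j : Fin n) :
    toggle (toggle x i) j = toggle (toggle x j) i := by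
  funext k
  by_cases hi : k = i <;> by_cases hj : k = j
  · subst hi; subst hj; rfl
  · subst hi; simp [toggle_of_ne _ hj]
  · subst hj; simp [toggle_of_ne _ hi]
  · simp [toggle_of_ne _ hi, toggle_of_ne _ hj]

theorem toggle_eq_toggle_iff (x : Fin n → Bool) (i j : Fin n) :
    toggle x i = toggle x j ↔ i = j := by
  refine ⟨fun h => ?_, fun h => by rw [h]⟩
  by_contra hne
  have := congrFun h i
  simp [toggle_of_ne _ hne] at this

theorem adj_iff_exists_toggle (x y : Fin n → Bool) :
    (hypercube n).Adj x y ↔ ∃ i, y = toggle x i := by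
  change hammingDist x y = 1 ↔ _
  rw [hammingDist, Finset.card_eq_one]
  constructor
  · rintro ⟨i, hi⟩
    refine ⟨i, funext fun j => ?_⟩
    have hj := Finset.ext_iff.1 hi j
    simp only [Finset.mem_filter, Finset.mem_univ, true_and, Finset.mem_singleton] at hj
    by_cases h : j = i
    · subst h
      have := hj.2 rfl
      rw [toggle_same]
      revert this
      cases x j <;> cases y j <;> simp
    · rw [toggle_of_ne _ h]
      by_contra hne
      exact h (hj.1 (Ne.symm hne))
  · rintro ⟨i, rfl⟩
    refine ⟨i, Finset.ext fun j => ?_⟩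
    by_cases h : j = i
    · subst h; simp
    · simp [toggle_of_ne _ h, h]

theorem adj_toggle (x : Fin n → Bool) (i : Fin n) : (hypercube n).Adj x (toggle x i) :=
  (adj_iff_exists_toggle _ _).2 ⟨i, rfl⟩

/-- A function on the hypercube that no single change of position affects is constant. -/
theorem eq_of_toggle_invariant {β : Type*} (g : (Fin n → Bool) → β)
    (hg : ∀ x i, g (toggle x i) = g x) (x y : Fin n → Bool) : g x = g y := by
  have key : ∀ s : Finset (Fin n), ∀ x y : Fin n → Bool, (∀ i ∉ s, x i = y i) → g x = g y := by
    intro s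
    induction s using Finset.induction with
    | empty => intro x y h; rw [funext fun i => h i (by simp)]
    | insert a s _ ih =>
      intro x y h
      by_cases hxy : x a = y a
      · refine ih x y fun i hi => ?_
        by_cases hia : i = a
        · rw [hia, hxy]
        · exact h i (by simp [hi, hia])
      · rw [← hg x a]
        refine ih _ y fun i hi => ?_
        by_cases hia : i = a
        · subst hia
          rw [toggle_same]
          revert hxy
          cases x i <;> cases y i <;> simp
        · rw [toggle_of_ne _ hia]
          exact h i (by simp [hi, hia])
  exact key Finset.univ x y fun i hi => absurd (Finset.mem_univ i) hi

end Toggle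

/-! ### Walks of bounded length inside a vertex set. -/

section JoinedWithin

variable {n : ℕ}

/-- There is a walk of length at most `L` from `u` to `v` in the hypercube, all of whose vertices
lie in `X`. -/
def JoinedWithin (X : Set (Fin n → Bool)) (u v : Fin n → Bool) (L : ℕ) : Prop :=
  ∃ p : (hypercube n).Walk u v, p.length ≤ L ∧ ∀ x ∈ p.support, x ∈ X

theorem JoinedWithin.refl {X : Set (Fin n → Bool)} {u : Fin n → Bool} (hu : u ∈ X) :
    JoinedWithin X u u 0 :=
  ⟨.nil, by simp, by simpa using hu⟩

theorem JoinedWithin.mono {X : Set (Fin n → Bool)} {u v : Fin n → Bool} {L L' : ℕ}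
    (h : JoinedWithin X u v L) (hL : L ≤ L') : JoinedWithin X u v L' := by
  obtain ⟨p, hp, hX⟩ := h
  exact ⟨p, hp.trans hL, hX⟩

theorem JoinedWithin.symm {X : Set (Fin n → Bool)} {u v : Fin n → Bool} {L : ℕ}
    (h : JoinedWithin X u v L) : JoinedWithin X v u L := by
  obtain ⟨p, hp, hX⟩ := h
  exact ⟨p.reverse, by simpa using hp, by simpa using hX⟩

theorem JoinedWithin.trans {X : Set (Fin n → Bool)} {u v w : Fin n → Bool} {L L' : ℕ}
    (h : JoinedWithin X u v L) (h' : JoinedWithin X v w L') : JoinedWithin X u w (L + L') := by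
  obtain ⟨p, hp, hX⟩ := h
  obtain ⟨q, hq, hX'⟩ := h'
  refine ⟨p.append q, by rw [SimpleGraph.Walk.length_append]; omega, fun x hx => ?_⟩
  rw [SimpleGraph.Walk.mem_support_append_iff] at hx
  exact hx.elim (hX x) (hX' x)

theorem joinedWithin_toggle {X : Set (Fin n → Bool)} {u : Fin n → Bool} {i : Fin n}
    (hu : u ∈ X) (hi : toggle u i ∈ X) : JoinedWithin X u (toggle u i) 1 :=
  ⟨.cons (adj_toggle u i) .nil, by simp, by simp [hu, hi]⟩

theorem JoinedWithin.toggle_left {X : Set (Fin n → Bool)} {u v : Fin n → Bool} {i : Fin n} {L : ℕ}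
    (hu : u ∈ X) (h : JoinedWithin X (toggle u i) v L) : JoinedWithin X u v (L + 1) := by
  obtain ⟨p, hp, hX⟩ := h
  refine ⟨.cons (adj_toggle u i) p, by simpa using hp, fun x hx => ?_⟩
  rw [SimpleGraph.Walk.support_cons, List.mem_cons] at hx
  rcases hx with rfl | hx
  · exact hu
  · exact hX x hx

end JoinedWithin

/-! ### Geodesics between antipodal strings. -/

section Subcube

variable {n : ℕ}

/-- The subcube of all strings that agree with `C.2` at the positions in `C.1`. -/
def subcube (C : Finset (Fin n) × (Fin n → Bool)) : Set (Fin n → Bool) :=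
  {x | ∀ i ∈ C.1, x i = C.2 i}

theorem mem_of_toggle_mem_of_notMem {C : Finset (Fin n) × (Fin n → Bool)} {u : Fin n → Bool}
    {i : Fin n} (hi : toggle u i ∈ subcube C) (hu : u ∉ subcube C) :
    i ∈ C.1 ∧ C.2 i = !u i := by
  have hmem : i ∈ C.1 := by
    by_contra h
    refine hu fun j hj => ?_
    have hne : j ≠ i := fun e => h (e ▸ hj)
    rw [← hi j hj, toggle_of_ne _ hne]
  exact ⟨hmem, by rw [← hi i hmem, toggle_same]⟩

/-- The only direction leading from `u` into the subcube is the single fixed position at which `u`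
violates it. Hence different blocked directions need different subcubes, which makes the final count
in `joinedWithin_of_antipodal` work. -/
theorem eq_of_toggle_mem {C : Finset (Fin n) × (Fin n → Bool)} {u : Fin n → Bool}
    {i j : Fin n} (hi : toggle u i ∈ subcube C) (hj : toggle u j ∈ subcube C)
    (hu : u ∉ subcube C) : i = j := by
  by_contra hne
  have h1 := (mem_of_toggle_mem_of_notMem hi hu)
  have h2 := hj i h1.1
  rw [toggle_of_ne _ hne, h1.2] at h2
  simp at h2

/-- Two strings that differ exactly on `A` are joined by a geodesic avoiding a family of subcubes,
if each subcube is fixed at more positions in `A` than there are subcubes. -/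
theorem joinedWithin_of_antipodal (X : Set (Fin n → Bool)) (k : ℕ) :
    ∀ (A : Finset (Fin n)) (F : Finset (Finset (Fin n) × (Fin n → Bool))) (u v : Fin n → Bool),
      A.card = k → (∀ i ∉ A, u i = v i) → (∀ i ∈ A, u i = !v i) →
      (∀ C ∈ F, u ∉ subcube C) → (∀ C ∈ F, v ∉ subcube C) →
      (∀ C ∈ F, F.card < (C.1 ∩ A).card) →
      (∀ x, (∀ i ∉ A, x i = u i) → x ∉ X → ∃ C ∈ F, x ∈ subcube C) →
      JoinedWithin X u v k := by
  classical
  induction k with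
  | zero =>
    intro A F u v hA hoff _ hu _ _ hX
    have hA : A = ∅ := Finset.card_eq_zero.1 hA
    obtain rfl : u = v := funext fun i => hoff i (by simp [hA])
    refine .refl ?_
    by_contra h
    obtain ⟨C, hC, hmem⟩ := hX u (fun _ _ => rfl) h
    exact hu C hC hmem
  | succ k ih =>
    intro A F u v hA hoff hon hu hv hF hX
    have huX : u ∈ X := by
      by_contra h
      obtain ⟨C, hC, hmem⟩ := hX u (fun _ _ => rfl) h
      exact hu C hC hmem
    have hcard : ∀ i ∈ A, (A.erase i).card = k := fun i hi => by
      rw [Finset.card_erase_of_mem hi]; omega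
    have herase : ∀ (i : Fin n) (P : Finset (Fin n)),
        (P ∩ A).card ≤ (P ∩ A.erase i).card + 1 := fun i P => by
      rw [Finset.inter_erase]
      have := Finset.pred_card_le_card_erase (s := P ∩ A) (a := i)
      omega
    -- the move at the start
    have moveU : ∀ i ∈ A, ∀ F' ⊆ F, (∀ C ∈ F, C ∉ F' → i ∈ C.1 ∧ C.2 i = u i) →
        (∀ C ∈ F', toggle u i ∉ subcube C) →
        (∀ C ∈ F', F'.card < (C.1 ∩ A.erase i).card) → JoinedWithin X u v (k + 1) := by
      intro i hi F' hF' hdead huF' hc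
      refine .toggle_left (i := i) huX (ih (A.erase i) F' _ v (hcard i hi) ?_ ?_ huF'
        (fun C hC => hv C (hF' hC)) hc ?_)
      · intro j hj
        by_cases hji : j = i
        · subst hji; rw [toggle_same, hon j hi, Bool.not_not]
        · rw [toggle_of_ne _ hji]; exact hoff j fun h => hj (Finset.mem_erase.2 ⟨hji, h⟩)
      · intro j hj
        rw [toggle_of_ne _ (Finset.ne_of_mem_erase hj)]
        exact hon j (Finset.mem_of_mem_erase hj)
      · intro x hx hxX
        obtain ⟨C, hC, hmem⟩ := hX x (fun j hj => by
          rw [hx j (fun h => hj (Finset.mem_of_mem_erase h)),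
            toggle_of_ne _ (ne_of_mem_of_not_mem hi hj).symm]) hxX
        refine ⟨C, ?_, hmem⟩
        by_contra hCF
        have h1 := hdead C hC hCF
        have h2 := hx i (by simp)
        rw [hmem i h1.1, h1.2, toggle_same] at h2
        simp at h2
    -- the move at the end
    have moveV : ∀ i ∈ A, ∀ F' ⊆ F, (∀ C ∈ F, C ∉ F' → i ∈ C.1 ∧ C.2 i = v i) →
        (∀ C ∈ F, toggle v i ∉ subcube C) →
        (∀ C ∈ F', F'.card < (C.1 ∩ A.erase i).card) → JoinedWithin X u v (k + 1) := by
      intro i hi F' hF' hdead hvF hc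
      have hvX : v ∈ X := by
        by_contra h
        obtain ⟨C, hC, hmem⟩ := hX v (fun i hi => (hoff i hi).symm) h
        exact hv C hC hmem
      refine (JoinedWithin.toggle_left (i := i) hvX (JoinedWithin.symm
        (ih (A.erase i) F' u _ (hcard i hi) ?_ ?_
        (fun C hC => hu C (hF' hC)) (fun C hC => hvF C (hF' hC)) hc ?_))).symm
      · intro j hj
        by_cases hji : j = i
        · subst hji; rw [toggle_same, hon j hi]
        · rw [toggle_of_ne _ hji]; exact hoff j fun h => hj (Finset.mem_erase.2 ⟨hji, h⟩)
      · intro j hj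
        rw [toggle_of_ne _ (Finset.ne_of_mem_erase hj)]
        exact hon j (Finset.mem_of_mem_erase hj)
      · intro x hx hxX
        obtain ⟨C, hC, hmem⟩ := hX x (fun j hj =>
          hx j (fun h => hj (Finset.mem_of_mem_erase h))) hxX
        refine ⟨C, ?_, hmem⟩
        by_contra hCF
        have h1 := hdead C hC hCF
        have h2 := hx i (by simp)
        rw [hmem i h1.1, h1.2, hon i hi] at h2
        simp at h2
    -- Suppose that no first or last step reduces to a smaller slice. It will follow that every
    -- neighbour of `u` in a direction of `A` is deleted, which takes more subcubes than there are.
    by_contra hno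
    have hfix : ∀ i ∈ A, ∃ C ∈ F, i ∈ C.1 := by
      intro i hi
      by_contra! hfree
      refine hno (moveU i hi F subset_rfl (fun C hC h => absurd hC h) ?_ ?_)
      · intro C hC hmem
        exact hfree C hC (mem_of_toggle_mem_of_notMem hmem (hu C hC)).1
      · intro C hC
        rw [Finset.inter_erase, Finset.erase_eq_of_notMem (by simp [hfree C hC])]
        exact hF C hC
    -- Fixing position `i` to the value `!b` kills at least one subcube, which pays for the fixed
    -- position that the others may lose.
    have smaller : ∀ (i : Fin n) (b : Bool), (∃ C ∈ F, i ∈ C.1 ∧ C.2 i = b) →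
        ∀ C ∈ F.filter (fun C => ¬ (i ∈ C.1 ∧ C.2 i = b)),
          (F.filter (fun C => ¬ (i ∈ C.1 ∧ C.2 i = b))).card < (C.1 ∩ A.erase i).card := by
      rintro i b ⟨C₀, hC₀, h₀⟩ C hC
      have h1 : (F.filter (fun C => ¬ (i ∈ C.1 ∧ C.2 i = b))).card < F.card :=
        Finset.card_lt_card (Finset.filter_ssubset.2 ⟨C₀, hC₀, not_not.2 h₀⟩)
      have h2 := hF C (Finset.mem_of_mem_filter C hC)
      have h3 := herase i C.1
      omega
    have fromU : ∀ i ∈ A, (∃ C ∈ F, i ∈ C.1 ∧ C.2 i = u i) → ∃ C ∈ F, toggle u i ∈ subcube C := by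
      intro i hi hC
      by_contra! hsafe
      refine hno (moveU i hi _ (Finset.filter_subset _ _) ?_
        (fun C hC => hsafe C (Finset.mem_of_mem_filter C hC)) (smaller i _ hC))
      intro C hC hCF
      by_contra h
      exact hCF (Finset.mem_filter.2 ⟨hC, h⟩)
    have fromV : ∀ i ∈ A, (∃ C ∈ F, i ∈ C.1 ∧ C.2 i = v i) → ∃ C ∈ F, toggle v i ∈ subcube C := by
      intro i hi hC
      by_contra! hsafe
      refine hno (moveV i hi _ (Finset.filter_subset _ _) ?_ hsafe (smaller i _ hC))
      intro C hC hCF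
      by_contra h
      exact hCF (Finset.mem_filter.2 ⟨hC, h⟩)
    have blocked : ∀ i ∈ A, ∃ C ∈ F, toggle u i ∈ subcube C := by
      intro i hi
      obtain ⟨C, hC, hiC⟩ := hfix i hi
      by_cases hval : C.2 i = u i
      · exact fromU i hi ⟨C, hC, hiC, hval⟩
      -- A subcube on the side of `v` makes the last step profitable, so that step must be blocked.
      -- The blocking subcube lies on the side of `u`, and the first step is then profitable as
      -- well.
      · obtain ⟨C', hC', hmem⟩ := fromV i hi ⟨C, hC, hiC, by
          rw [hon i hi] at hval; simpa using hval⟩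
        have h := mem_of_toggle_mem_of_notMem hmem (hv C' hC')
        exact fromU i hi ⟨C', hC', h.1, by rw [h.2, hon i hi]⟩
    choose! c hcF hcmem using blocked
    have hle : A.card ≤ F.card := Finset.card_le_card_of_injOn c hcF fun i hi j hj hij =>
      eq_of_toggle_mem (hcmem i hi) (hij ▸ hcmem j hj) (hu _ (hcF i hi))
    obtain ⟨i, hi⟩ : A.Nonempty := Finset.card_pos.1 (by omega)
    have h1 := hF _ (hcF i hi)
    have h2 := Finset.card_le_card (Finset.inter_subset_right (s₁ := (c i).1) (s₂ := A))
    omega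

end Subcube
-- Upper bounds on distances.
section Diameter

variable {n : ℕ}

/-- A set `T` of at most about half of the positions in `S` can be chosen such that the subcubes
that are free on `T` are fewer than the positions in `D` at which each of them is fixed. -/
theorem exists_half_hitting_set (F : Finset (Finset (Fin n) × (Fin n → Bool)))
    (D S : Finset (Fin n)) (hF : ∀ C ∈ F, F.card < (C.1 ∩ D).card + (C.1 ∩ S).card) :
    ∃ T ⊆ S, 2 * T.card ≤ S.card + 1 ∧
      ∀ C ∈ F, Disjoint C.1 T → (F.filter fun C => Disjoint C.1 T).card < (C.1 ∩ D).card := by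
  by_contra! hno
  -- Greedy choice: a subcube violating the conclusion for `T` still has a fixed position in `S`,
  -- and adding that position to `T` hits at least one more subcube.
  have step : ∀ t, 2 * t ≤ S.card + 1 →
      ∃ T ⊆ S, T.card = t ∧ (F.filter fun C => Disjoint C.1 T).card + t ≤ F.card := by
    intro t
    induction t with
    | zero => exact fun _ => ⟨∅, by simp, by simp, Finset.card_filter_le _ _⟩
    | succ t ih =>
      intro ht
      obtain ⟨T, hTS, hTc, hT⟩ := ih (by omega)
      obtain ⟨C, hC, hCT, hle⟩ := hno T hTS (by omega)
      have h1 := hF C hC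
      obtain ⟨s, hs⟩ : (C.1 ∩ S).Nonempty := Finset.card_pos.1 (by omega)
      have hsC := Finset.mem_of_mem_inter_left hs
      have hsT : s ∉ T := fun h => Finset.disjoint_left.1 hCT hsC h
      refine ⟨insert s T, Finset.insert_subset (Finset.mem_of_mem_inter_right hs) hTS,
        by rw [Finset.card_insert_of_notMem hsT, hTc], ?_⟩
      have : (F.filter fun C => Disjoint C.1 (insert s T)).card <
          (F.filter fun C => Disjoint C.1 T).card := by
        refine Finset.card_lt_card (Finset.ssubset_iff_subset_ne.2 ⟨fun C' hC' => ?_, fun h => ?_⟩)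
        · rw [Finset.mem_filter] at hC' ⊢
          exact ⟨hC'.1, hC'.2.mono_right (Finset.subset_insert _ _)⟩
        · have hmem : C ∈ F.filter fun C => Disjoint C.1 T := Finset.mem_filter.2 ⟨hC, hCT⟩
          rw [← h, Finset.mem_filter] at hmem
          exact Finset.disjoint_left.1 hmem.2 hsC (Finset.mem_insert_self _ _)
      omega
  -- At this size a violating subcube would have more than `#T` fixed positions in `S \ T`, which
  -- has at most `#T` elements.
  obtain ⟨T, hTS, hTc, hT⟩ := step ((S.card + 1) / 2) (by omega)
  obtain ⟨C, hC, hCT, hle⟩ := hno T hTS (by omega)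
  have h1 := hF C hC
  have h2 : (C.1 ∩ S).card ≤ (S \ T).card := Finset.card_le_card fun i hi => by
    rw [Finset.mem_inter] at hi
    exact Finset.mem_sdiff.2 ⟨hi.2, fun h => Finset.disjoint_left.1 hCT hi.1 h⟩
  rw [Finset.card_sdiff_of_subset hTS] at h2
  omega

/-- The string obtained from `u` by changing all positions in `T`. -/
def toggleAll (u : Fin n → Bool) (T : Finset (Fin n)) : Fin n → Bool :=
  fun i => if i ∈ T then !u i else u i

theorem joinedWithin_toggleAll (X : Set (Fin n → Bool)) (u : Fin n → Bool) (T : Finset (Fin n))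
    (hX : ∀ T' ⊆ T, toggleAll u T' ∈ X) : JoinedWithin X u (toggleAll u T) T.card := by
  induction T using Finset.induction with
  | empty =>
    have h := hX ∅ subset_rfl
    have he : toggleAll u ∅ = u := funext fun i => by simp [toggleAll]
    rw [he] at h ⊢
    exact .refl h
  | insert a T ha ih =>
    have h1 := ih fun T' hT' => hX T' (hT'.trans (Finset.subset_insert _ _))
    have he : toggleAll u (insert a T) = toggle (toggleAll u T) a := by
      funext i
      by_cases h : i = a
      · subst h; simp [toggleAll, ha]
      · rw [toggle_of_ne _ h]; simp [toggleAll, h]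
    rw [Finset.card_insert_of_notMem ha, he]
    refine h1.trans (joinedWithin_toggle (hX T (Finset.subset_insert _ _)) ?_)
    rw [← he]
    exact hX _ subset_rfl

/-- Within a slice of the hypercube with free positions `A`, any two strings are joined by a walk of
length at most `#A + 1` that avoids a family of subcubes, if each subcube is fixed at more
positions in `A` than there are subcubes. -/
theorem joinedWithin_of_card_lt (X : Set (Fin n → Bool)) (k : ℕ) :
    ∀ (A : Finset (Fin n)) (F : Finset (Finset (Fin n) × (Fin n → Bool))) (u v : Fin n → Bool),
      A.card = k → (∀ i ∉ A, u i = v i) →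
      (∀ C ∈ F, u ∉ subcube C) → (∀ C ∈ F, v ∉ subcube C) →
      (∀ C ∈ F, F.card < (C.1 ∩ A).card) →
      (∀ x, (∀ i ∉ A, x i = u i) → x ∉ X → ∃ C ∈ F, x ∈ subcube C) →
      JoinedWithin X u v (k + 1) := by
  induction k using Nat.strong_induction_on with
  | _ k ih =>
  intro A F u v hA hoff hu hv hF hX
  -- A subcube fixed against `u` and `v` at a position where they agree disappears on restricting to
  -- their common half-cube. Otherwise every subcube agrees with both at its fixed positions in `S`,
  -- so flips there only lead away from subcubes.
  by_cases hopp : ∃ i ∈ A, u i = v i ∧ ∃ C ∈ F, i ∈ C.1 ∧ C.2 i ≠ u i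
  · obtain ⟨i, hi, huv, C₀, hC₀, hiC₀⟩ := hopp
    have hpos : 0 < A.card := Finset.card_pos.2 ⟨i, hi⟩
    refine (ih (k - 1) (by omega) (A.erase i) (F.filter fun C => ¬ (i ∈ C.1 ∧ C.2 i ≠ u i)) u v
      (by rw [Finset.card_erase_of_mem hi, hA]) ?_ (fun C hC => hu C (Finset.mem_of_mem_filter C hC))
      (fun C hC => hv C (Finset.mem_of_mem_filter C hC)) ?_ ?_).mono (by omega)
    · intro j hj
      by_cases hji : j = i
      · rw [hji, huv]
      · exact hoff j fun h => hj (Finset.mem_erase.2 ⟨hji, h⟩)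
    · intro C hC
      have h1 : (F.filter fun C => ¬ (i ∈ C.1 ∧ C.2 i ≠ u i)).card < F.card :=
        Finset.card_lt_card (Finset.filter_ssubset.2 ⟨C₀, hC₀, not_not.2 hiC₀⟩)
      have h2 := hF C (Finset.mem_of_mem_filter C hC)
      have h3 := Finset.pred_card_le_card_erase (s := C.1 ∩ A) (a := i)
      rw [Finset.inter_erase]
      omega
    · intro x hx hxX
      obtain ⟨C, hC, hmem⟩ := hX x (fun j hj => hx j fun h => hj (Finset.mem_of_mem_erase h)) hxX
      refine ⟨C, Finset.mem_filter.2 ⟨hC, fun h => h.2 ?_⟩, hmem⟩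
      rw [← hmem i h.1, hx i (by simp)]
  · push Not at hopp
    have hunion : ∀ P : Finset (Fin n), (P ∩ A).card =
        (P ∩ A.filter fun i => ¬ u i = v i).card + (P ∩ A.filter fun i => u i = v i).card := by
      intro P
      rw [Finset.inter_filter, Finset.inter_filter, add_comm,
        Finset.card_filter_add_card_filter_not]
    have hcard := hunion A
    rw [Finset.inter_self, Finset.inter_eq_right.2 (Finset.filter_subset _ _),
      Finset.inter_eq_right.2 (Finset.filter_subset _ _)] at hcard
    set D := A.filter fun i => ¬ u i = v i with hD
    set S := A.filter fun i => u i = v i with hS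
    obtain ⟨T, hTS, hTc, hT⟩ := exists_half_hitting_set F D S
      (fun C hC => by rw [← hunion]; exact hF C hC)
    have hTA : ∀ i ∈ T, i ∈ A := fun i hi => (Finset.mem_filter.1 (hTS hi)).1
    have hTuv : ∀ i ∈ T, u i = v i := fun i hi => (Finset.mem_filter.1 (hTS hi)).2
    -- changing positions in `T` cannot lead into a subcube
    have safe : ∀ w : Fin n → Bool, (∀ i ∈ T, w i = u i) → (∀ C ∈ F, w ∉ subcube C) →
        ∀ T' ⊆ T, ∀ C ∈ F, toggleAll w T' ∉ subcube C := by
      intro w hwT hw T' hT' C hC hmem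
      refine hw C hC fun i hi => ?_
      by_cases hiT : i ∈ T'
      · rw [hwT i (hT' hiT), hopp i (hTA i (hT' hiT)) (hTuv i (hT' hiT)) C hC hi]
      · rw [← hmem i hi, toggleAll, if_neg hiT]
    have reach : ∀ w : Fin n → Bool, (∀ i ∈ T, w i = u i) → (∀ i ∉ A, w i = u i) →
        (∀ C ∈ F, w ∉ subcube C) → JoinedWithin X w (toggleAll w T) T.card := by
      intro w hwT hwA hw
      refine joinedWithin_toggleAll X w T fun T' hT' => ?_
      by_contra hnX
      obtain ⟨C, hC, hmem⟩ := hX _ (fun i hi => by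
        rw [toggleAll, if_neg fun h => hi (hTA i (hT' h)), hwA i hi]) hnX
      exact safe w hwT hw T' hT' C hC hmem
    have hvT : ∀ i ∈ T, v i = u i := fun i hi => (hTuv i hi).symm
    -- With `T` flipped, every subcube fixed somewhere in `T` is out of reach, so only those free on
    -- `T` matter.
    have hmid : JoinedWithin X (toggleAll u T) (toggleAll v T) D.card := by
      refine joinedWithin_of_antipodal X D.card D (F.filter fun C => Disjoint C.1 T) _ _ rfl
        ?_ ?_ ?_ ?_ ?_ ?_
      · intro i hi
        have : u i = v i := by
          by_cases hiA : i ∈ A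
          · by_contra h
            exact hi (Finset.mem_filter.2 ⟨hiA, h⟩)
          · exact hoff i hiA
        simp [toggleAll, this]
      · intro i hi
        have hne := (Finset.mem_filter.1 hi).2
        have hiT : i ∉ T := fun h => hne (hTuv i h)
        simp only [toggleAll, if_neg hiT]
        revert hne
        cases u i <;> cases v i <;> simp
      · exact fun C hC => safe u (fun _ _ => rfl) hu T subset_rfl C (Finset.mem_of_mem_filter C hC)
      · exact fun C hC => safe v hvT hv T subset_rfl C (Finset.mem_of_mem_filter C hC)
      · exact fun C hC => hT C (Finset.mem_filter.1 hC).1 (Finset.mem_filter.1 hC).2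
      · intro x hx hxX
        obtain ⟨C, hC, hmem⟩ := hX x (fun i hi => by
          rw [hx i fun h => hi (Finset.mem_filter.1 h).1, toggleAll,
            if_neg fun h => hi (hTA i h)]) hxX
        refine ⟨C, Finset.mem_filter.2 ⟨hC, Finset.disjoint_left.2 fun i hi hiT => ?_⟩, hmem⟩
        have h1 := hx i fun h => (Finset.mem_filter.1 h).2 (hTuv i hiT)
        rw [hmem i hi, hopp i (hTA i hiT) (hTuv i hiT) C hC hi, toggleAll, if_pos hiT] at h1
        simp at h1
    -- The length is `#D + 2 * #T`, at most `#D + #S + 1 = #A + 1`.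
    exact (((reach u (fun _ _ => rfl) (fun _ _ => rfl) hu).trans hmid).trans
      (reach v hvT (fun i hi => (hoff i hi).symm) hv).symm).mono (by omega)

/-- Removing a single subcube does not increase distances. -/
theorem joinedWithin_of_card_le_one (X : Set (Fin n → Bool))
    (F : Finset (Finset (Fin n) × (Fin n → Bool))) (hF : F.card ≤ 1) (u v : Fin n → Bool)
    (hu : ∀ C ∈ F, u ∉ subcube C) (hv : ∀ C ∈ F, v ∉ subcube C)
    (hX : ∀ x, x ∉ X → ∃ C ∈ F, x ∈ subcube C) : JoinedWithin X u v n := by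
  set D : Finset (Fin n) := Finset.univ.filter fun i => u i ≠ v i with hD
  have hDn : D.card ≤ n := (Finset.card_filter_le _ _).trans (by simp)
  have hoff : ∀ i ∉ D, u i = v i := fun i hi => by simpa [hD] using hi
  have hon : ∀ i ∈ D, u i = !v i := fun i hi => by
    have := (Finset.mem_filter.1 hi).2
    revert this
    cases u i <;> cases v i <;> simp
  refine (joinedWithin_of_antipodal X D.card D
    (F.filter fun C => ∀ i ∈ C.1, i ∉ D → C.2 i = u i) u v rfl hoff hon
    (fun C hC => hu C (Finset.mem_of_mem_filter C hC))
    (fun C hC => hv C (Finset.mem_of_mem_filter C hC)) ?_ ?_).mono hDn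
  · intro C hC
    obtain ⟨hC, hcons⟩ := Finset.mem_filter.1 hC
    -- The subcube violates `u` at one position and `v` at another. Both lie in `D` because it is
    -- consistent with them off `D`; they differ because on `D` it must agree with one of the two
    -- strings.
    refine ((Finset.card_filter_le _ _).trans hF).trans_lt (Finset.one_lt_card.2 ?_)
    obtain ⟨i, hi, hui⟩ : ∃ i ∈ C.1, u i ≠ C.2 i := by
      by_contra! h; exact hu C hC h
    obtain ⟨j, hj, hvj⟩ : ∃ j ∈ C.1, v j ≠ C.2 j := by
      by_contra! h; exact hv C hC h
    have hiD : i ∈ D := by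
      by_contra h; exact hui (hcons i hi h).symm
    have hjD : j ∈ D := by
      by_contra h; exact hvj (by rw [hcons j hj h, hoff j h])
    refine ⟨i, Finset.mem_inter.2 ⟨hi, hiD⟩, j, Finset.mem_inter.2 ⟨hj, hjD⟩, ?_⟩
    rintro rfl
    have := hon i hiD
    revert this hui hvj
    cases u i <;> cases v i <;> cases C.2 i <;> simp
  · intro x hx hxX
    obtain ⟨C, hC, hmem⟩ := hX x hxX
    exact ⟨C, Finset.mem_filter.2 ⟨hC, fun i hi hiD => by rw [← hmem i hi, hx i hiD]⟩, hmem⟩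

end Diameter

/-! ### Copies of hypercubes are subcubes. -/

section Embedding

variable {n m : ℕ}

/-- An injective homomorphism between hypercubes maps onto a subcube. -/
theorem exists_range_eq_subcube (f : (Fin m → Bool) → Fin n → Bool) (hf : Function.Injective f)
    (hadj : ∀ x y, (hypercube m).Adj x y → (hypercube n).Adj (f x) (f y)) :
    ∃ C : Finset (Fin n) × (Fin n → Bool), n ≤ C.1.card + m ∧ Set.range f = subcube C := by
  have hdir : ∀ x i, ∃ d, f (toggle x i) = toggle (f x) d := fun x i =>
    (adj_iff_exists_toggle _ _).1 (hadj _ _ (adj_toggle x i))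
  choose d hd using hdir
  -- Parallel edges have parallel images: a 4-cycle maps to a closed walk of four flips, and
  -- injectivity leaves only opposite edges to cancel each other.
  have hconst : ∀ i x y, d x i = d y i := by
    refine fun i => eq_of_toggle_invariant (fun x => d x i) fun x j => ?_
    by_cases hij : i = j
    · subst hij
      have h := hd (toggle x i) i
      rw [toggle_toggle, hd x i] at h
      have h' := congrArg (fun z => toggle z (d (toggle x i) i)) h
      simp only [toggle_toggle] at h'
      exact (toggle_eq_toggle_iff _ _ _).1 h'
    · have hp : d x i ≠ d x j := fun h => hij ((toggle_eq_toggle_iff x i j).1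
        (hf (by rw [hd, hd, h])))
      have h1 : toggle (toggle (f x) (d x j)) (d (toggle x j) i) =
          toggle (toggle (f x) (d x i)) (d (toggle x i) j) := by
        rw [← hd, ← hd, ← hd, ← hd, toggle_comm]
      have hq : d x i ≠ d (toggle x i) j := by
        intro h
        have h2 : f (toggle (toggle x i) j) = f x := by
          rw [hd, hd, ← h, toggle_toggle]
        have h3 := congrFun (hf h2) i
        rw [toggle_of_ne _ hij] at h3
        simp at h3
      by_contra hne
      have h4 := congrFun h1 (d x i)
      rw [toggle_of_ne _ (Ne.symm hne), toggle_of_ne _ hp, toggle_of_ne _ hq] at h4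
      simp at h4
  let x₀ : Fin m → Bool := fun _ => false
  let R : Finset (Fin n) := Finset.univ.image (d x₀)
  have hR : R.card ≤ m := Finset.card_image_le.trans (by simp)
  have hoff : ∀ j ∉ R, ∀ x, f x j = f x₀ j := by
    intro j hj x
    refine eq_of_toggle_invariant (fun x => f x j) (fun x i => ?_) x x₀
    rw [hd, toggle_of_ne]
    rintro rfl
    exact hj (Finset.mem_image.2 ⟨i, Finset.mem_univ _, hconst i _ _⟩)
  refine ⟨(Rᶜ, f x₀), ?_, ?_⟩
  · have := Finset.card_add_card_compl R
    rw [Fintype.card_fin] at this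
    change n ≤ Rᶜ.card + m
    omega
  · have hsub : Set.range f ⊆ subcube (Rᶜ, f x₀) := by
      rintro _ ⟨x, rfl⟩ j hj
      exact hoff j (Finset.mem_compl.1 hj) x
    -- Equality by counting: the image has `2 ^ m` points, and the subcube at most `2 ^ R.card`.
    refine Set.eq_of_subset_of_ncard_le hsub ?_ (Set.toFinite _)
    have h1 : (Set.range f).ncard = 2 ^ m := by
      rw [← Set.image_univ, Set.ncard_image_of_injective _ hf, Set.ncard_univ]
      simp
    let r : subcube (Rᶜ, f x₀) → (R → Bool) := fun x i => x.1 i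
    have hr : Function.Injective r := by
      intro x y hxy
      refine Subtype.ext (funext fun j => ?_)
      by_cases hj : j ∈ R
      · exact congrFun hxy ⟨j, hj⟩
      · rw [x.2 j (Finset.mem_compl.2 hj), y.2 j (Finset.mem_compl.2 hj)]
    have h2 := Nat.card_le_card_of_injective r hr
    rw [Nat.card_coe_set_eq] at h2
    rw [h1]
    refine h2.trans ?_
    simp only [Nat.card_eq_fintype_card, Fintype.card_fun, Fintype.card_bool, Fintype.card_coe]
    exact Nat.pow_le_pow_right (by norm_num) hR

theorem exists_verts_eq_subcube (H : (hypercube n).Subgraph)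
    (hH : Nonempty (H.coe ≃g hypercube m)) :
    ∃ C : Finset (Fin n) × (Fin n → Bool), n ≤ C.1.card + m ∧ H.verts = subcube C := by
  obtain ⟨e⟩ := hH
  obtain ⟨C, hC, h⟩ := exists_range_eq_subcube (fun x => (e.symm x).1)
    (fun x y hxy => e.symm.injective (Subtype.ext hxy))
    (fun x y hxy => H.adj_sub (e.symm.map_adj_iff.2 hxy))
  refine ⟨C, hC, h ▸ Set.ext fun x => ⟨fun hx => ⟨e ⟨x, hx⟩, by simp⟩, ?_⟩⟩
  rintro ⟨y, rfl⟩
  exact (e.symm y).2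

/-- The vertex set removed by a structure family is a union of as many subcubes. -/
theorem IsStructureFamily.exists_subcubes {F : Finset (hypercube n).Subgraph}
    (hF : IsStructureFamily (hypercube n) (hypercube m) F) :
    ∃ K : Finset (Finset (Fin n) × (Fin n → Bool)), K.card ≤ F.card ∧
      (∀ C ∈ K, n ≤ C.1.card + m) ∧
      ∀ x, (∀ H ∈ F, x ∉ H.verts) ↔ ∀ C ∈ K, x ∉ subcube C := by
  classical
  choose! c hc hcv using fun H hH => exists_verts_eq_subcube H (hF.1 H hH)
  refine ⟨F.image c, Finset.card_image_le, ?_, fun x => ?_⟩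
  · simpa using hc
  · simp only [Finset.forall_mem_image]
    exact forall₂_congr fun H hH => by rw [hcv H hH]

theorem edist_remove_le {F : Finset (hypercube n).Subgraph}
    (u v : {x : Fin n → Bool | ∀ H ∈ F, x ∉ H.verts}) {L : ℕ}
    (h : JoinedWithin {x : Fin n → Bool | ∀ H ∈ F, x ∉ H.verts} u v L) :
    (remove (hypercube n) F).edist u v ≤ L := by
  obtain ⟨p, hp, hX⟩ := h
  have h1 := SimpleGraph.edist_le (p.induce _ hX)
  refine h1.trans ?_
  rw [← SimpleGraph.Walk.length_map (SimpleGraph.Embedding.induce _).toHom,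
    SimpleGraph.Walk.map_induce]
  exact_mod_cast hp

theorem edist_remove_le_succ {F : Finset (hypercube n).Subgraph}
    (hF : IsStructureFamily (hypercube n) (hypercube m) F) (hcard : F.card + m < n)
    (u v : {x : Fin n → Bool | ∀ H ∈ F, x ∉ H.verts}) :
    (remove (hypercube n) F).edist u v ≤ (n + 1 : ℕ) := by
  obtain ⟨K, hKc, hKm, hK⟩ := hF.exists_subcubes
  refine edist_remove_le u v (joinedWithin_of_card_lt _ n Finset.univ K u v (by simp) (by simp)
    ((hK _).1 u.2) ((hK _).1 v.2) (fun C hC => ?_) (fun x _ hx => ?_))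
  · have := hKm C hC
    rw [Finset.inter_univ]
    omega
  · rw [Set.mem_ofPred_eq, hK] at hx
    push Not at hx
    exact hx

theorem edist_remove_le_of_card_le_one {F : Finset (hypercube n).Subgraph}
    (hF : IsStructureFamily (hypercube n) (hypercube m) F) (hcard : F.card ≤ 1)
    (u v : {x : Fin n → Bool | ∀ H ∈ F, x ∉ H.verts}) :
    (remove (hypercube n) F).edist u v ≤ n := by
  obtain ⟨K, hKc, hKm, hK⟩ := hF.exists_subcubes
  refine edist_remove_le u v (joinedWithin_of_card_le_one _ K (hKc.trans hcard) u v
    ((hK _).1 u.2) ((hK _).1 v.2) (fun x hx => ?_))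
  rw [Set.mem_ofPred_eq, hK] at hx
  push Not at hx
  exact hx

end Embedding
-- Neighbouring subcubes and forced detours.
section Extremal

variable {n m : ℕ}

/-- The subgraph induced on the strings that agree with `a` from position `m` on. -/
def prefixCube (m : ℕ) (a : Fin n → Bool) : (hypercube n).Subgraph :=
  (⊤ : (hypercube n).Subgraph).induce {x | ∀ i : Fin n, m ≤ i.1 → x i = a i}

/-- The string that has the first `m` entries of `y` and agrees with `a` afterwards. -/
def prefixExtend (a : Fin n → Bool) (y : Fin m → Bool) : Fin n → Bool :=
  fun i => if h : i.1 < m then y ⟨i.1, h⟩ else a i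

theorem prefixExtend_castLE (hmn : m ≤ n) (a : Fin n → Bool) (y : Fin m → Bool) (i : Fin m) :
    prefixExtend a y (Fin.castLE hmn i) = y i := by
  simp [prefixExtend]

theorem prefixExtend_toggle (hmn : m ≤ n) (a : Fin n → Bool) (y : Fin m → Bool) (i : Fin m) :
    prefixExtend a (toggle y i) = toggle (prefixExtend a y) (Fin.castLE hmn i) := by
  funext j
  by_cases h : j = Fin.castLE hmn i
  · subst h; rw [toggle_same, prefixExtend_castLE, prefixExtend_castLE, toggle_same]
  · rw [toggle_of_ne _ h]
    by_cases hj : j.1 < m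
    · have : (⟨j.1, hj⟩ : Fin m) ≠ i := fun e => h (by rw [← e]; rfl)
      simp [prefixExtend, hj, toggle_of_ne _ this]
    · simp [prefixExtend, hj]

/-- The prefix cubes are copies of the hypercube. -/
def prefixCubeIso (hmn : m ≤ n) (a : Fin n → Bool) :
    (prefixCube m a).coe ≃g hypercube m where
  toFun x i := x.1 (Fin.castLE hmn i)
  invFun y := ⟨prefixExtend a y, fun i hi => by simp [prefixExtend, not_lt.2 hi]⟩
  left_inv x := by
    refine Subtype.ext (funext fun i => ?_)
    by_cases h : i.1 < m
    · simp [prefixExtend, h]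
    · simpa [prefixExtend, h] using (x.2 i (not_lt.1 h)).symm
  right_inv y := funext fun i => prefixExtend_castLE hmn a y i
  map_rel_iff' := by
    intro x y
    have key : ∀ z : (prefixCube m a).verts,
        prefixExtend a (fun i => z.1 (Fin.castLE hmn i)) = z.1 := by
      intro z
      refine funext fun i => ?_
      by_cases h : i.1 < m
      · simp [prefixExtend, h]
      · simpa [prefixExtend, h] using (z.2 i (not_lt.1 h)).symm
    have hadj : (prefixCube m a).coe.Adj x y ↔ (hypercube n).Adj x.1 y.1 := by
      rw [SimpleGraph.Subgraph.coe_adj]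
      exact ⟨fun h => h.2.2, fun h => ⟨x.2, y.2, h⟩⟩
    rw [hadj, adj_iff_exists_toggle, adj_iff_exists_toggle]
    constructor
    · rintro ⟨i, hi⟩
      refine ⟨Fin.castLE hmn i, ?_⟩
      rw [← key y, ← key x, ← prefixExtend_toggle]
      exact congrArg _ hi
    · rintro ⟨i, hi⟩
      have him : i.1 < m := by
        by_contra h
        have h1 := x.2 i (not_lt.1 h)
        have h2 := y.2 i (not_lt.1 h)
        rw [hi, toggle_same, h1] at h2
        simp at h2
      refine ⟨⟨i.1, him⟩, funext fun j => ?_⟩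
      change y.1 _ = _
      by_cases hj : j = ⟨i.1, him⟩
      · subst hj
        rw [toggle_same, hi]
        exact toggle_same _ _
      · rw [toggle_of_ne _ hj, hi]
        exact toggle_of_ne _ fun e : Fin.castLE hmn j = i => hj (Fin.ext (congrArg Fin.val e :))

/-- The prefix cubes neighbouring the prefix cube of the zero string in the directions in `J`. -/
noncomputable def neighborCubes (m : ℕ) (J : Finset (Fin n)) : Finset (hypercube n).Subgraph :=
  open scoped Classical in J.image fun j => prefixCube m fun i => decide (i = j)

theorem mem_prefixCube_verts (a x : Fin n → Bool) :
    x ∈ (prefixCube m a).verts ↔ ∀ i : Fin n, m ≤ i.1 → x i = a i := Iff.rfl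

theorem eq_of_mem_neighborCubes {x : Fin n → Bool} {j k : Fin n} (hj : m ≤ j.1)
    (h : x ∈ (prefixCube m fun i => decide (i = j)).verts)
    (h' : x ∈ (prefixCube m fun i => decide (i = k)).verts) : j = k := by
  have h1 := h j hj
  have h2 := h' j hj
  rw [h1] at h2
  simpa using h2

theorem isStructureFamily_neighborCubes (hmn : m ≤ n) {J : Finset (Fin n)}
    (hJ : ∀ j ∈ J, m ≤ j.1) :
    IsStructureFamily (hypercube n) (hypercube m) (neighborCubes m J) := by
  classical
  refine ⟨fun H hH => ?_, fun H hH K hK hne => ?_⟩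
  · obtain ⟨j, _, rfl⟩ := Finset.mem_image.1 hH
    exact ⟨prefixCubeIso hmn _⟩
  · obtain ⟨j, hj, rfl⟩ := Finset.mem_image.1 hH
    obtain ⟨k, hk, rfl⟩ := Finset.mem_image.1 hK
    refine Set.disjoint_left.2 fun x hx hx' => hne ?_
    rw [eq_of_mem_neighborCubes (hJ j hj) hx hx']

theorem card_neighborCubes_le (J : Finset (Fin n)) : (neighborCubes m J).card ≤ J.card := by
  classical
  exact Finset.card_image_le

theorem notMem_neighborCubes_iff {J : Finset (Fin n)} {x : Fin n → Bool} :
    (∀ H ∈ neighborCubes m J, x ∉ H.verts) ↔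
      ∀ j ∈ J, ¬ ∀ i : Fin n, m ≤ i.1 → x i = decide (i = j) := by
  classical
  unfold neighborCubes
  simp only [Finset.forall_mem_image, mem_prefixCube_verts]

/-- A step out of the prefix cube of the zero string leads into one of the neighbouring cubes. -/
theorem exit_neighborCubes {J : Finset (Fin n)} {x : Fin n → Bool} {i : Fin n}
    (hx : ∀ i : Fin n, m ≤ i.1 → x i = false)
    (hsafe : ∀ H ∈ neighborCubes m J, toggle x i ∉ H.verts) (hi : m ≤ i.1) : i ∉ J := by
  rw [notMem_neighborCubes_iff] at hsafe
  refine fun hiJ => hsafe i hiJ fun k hk => ?_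
  by_cases h : k = i
  · subst h; simp [hx k hk]
  · simp [toggle_of_ne _ h, hx k hk, h]

theorem hammingDist_toggle_le (x y : Fin n → Bool) (i : Fin n) :
    hammingDist x y ≤ hammingDist (toggle x i) y + 1 := by
  have h1 := hammingDist_triangle x (toggle x i) y
  have h2 : hammingDist x (toggle x i) = 1 := adj_toggle x i
  omega

theorem hammingDist_toggle_of_eq {x y : Fin n → Bool} {i : Fin n} (h : x i = y i) :
    hammingDist (toggle x i) y = hammingDist x y + 1 := by
  have hset : (Finset.univ.filter fun j => toggle x i j ≠ y j) =
      insert i (Finset.univ.filter fun j => x j ≠ y j) := by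
    ext j
    by_cases hj : j = i
    · subst hj; simp [h]
    · simp [toggle_of_ne _ hj, hj]
  unfold hammingDist
  rw [hset, Finset.card_insert_of_notMem (by simp [h])]

theorem exists_toggle_of_remove_adj {F : Finset (hypercube n).Subgraph}
    {x y : {x : Fin n → Bool | ∀ H ∈ F, x ∉ H.verts}} (h : (remove (hypercube n) F).Adj x y) :
    ∃ i, y.1 = toggle x.1 i :=
  (adj_iff_exists_toggle _ _).1 h

theorem hammingDist_le_length {F : Finset (hypercube n).Subgraph}
    {x y : {x : Fin n → Bool | ∀ H ∈ F, x ∉ H.verts}} (p : (remove (hypercube n) F).Walk x y) :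
    hammingDist x.1 y.1 ≤ p.length := by
  induction p with
  | nil => simp
  | cons h p ih =>
    obtain ⟨i, hi⟩ := exists_toggle_of_remove_adj h
    rw [hi] at ih
    have := hammingDist_toggle_le _ _ i |>.trans (Nat.add_le_add_right ih 1)
    simpa using this

/-- Without the neighbouring cubes in all directions but `j`, a walk leaving the prefix cube of the
zero string makes a detour in direction `j`. -/
theorem hammingDist_add_two_le_length {J : Finset (Fin n)} {j : Fin n}
    (hJ : ∀ i : Fin n, m ≤ i.1 → i ≠ j → i ∈ J)
    {x y : {x : Fin n → Bool | ∀ H ∈ neighborCubes m J, x ∉ H.verts}}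
    (p : (remove (hypercube n) (neighborCubes m J)).Walk x y)
    (hx : ∀ i : Fin n, m ≤ i.1 → x.1 i = false)
    (hyj : y.1 j = false) (hy : ∃ i : Fin n, m ≤ i.1 ∧ y.1 i = true) :
    hammingDist x.1 y.1 + 2 ≤ p.length := by
  induction p with
  | nil =>
    obtain ⟨i, hi, hyi⟩ := hy
    rw [hx i hi] at hyi
    simp at hyi
  | @cons a b c h p ih =>
    obtain ⟨i, hi⟩ := exists_toggle_of_remove_adj h
    rw [SimpleGraph.Walk.length_cons]
    by_cases him : m ≤ i.1
    · have hij : i = j := by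
        by_contra hne
        exact exit_neighborCubes hx (hi ▸ b.2) him (hJ i him hne)
      -- The forced exit flips a position where the target already agrees: one step spent and the
      -- distance one larger, hence the surplus of two.
      have h1 := hammingDist_le_length p
      rw [hi, hammingDist_toggle_of_eq (by rw [hx i him, hij, hyj])] at h1
      omega
    · have h1 := ih (fun k hk => by
        rw [hi, toggle_of_ne _ (fun e : k = i => him (e ▸ hk)), hx k hk]) hyj hy
      have h2 := hammingDist_toggle_le a.1 c.1 i
      rw [← hi] at h2
      omega

/-- Without all neighbouring cubes, no walk leaves the prefix cube of the zero string. -/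
theorem eq_false_of_walk {J : Finset (Fin n)} (hJ : ∀ i : Fin n, m ≤ i.1 → i ∈ J)
    {x y : {x : Fin n → Bool | ∀ H ∈ neighborCubes m J, x ∉ H.verts}}
    (p : (remove (hypercube n) (neighborCubes m J)).Walk x y)
    (hx : ∀ i : Fin n, m ≤ i.1 → x.1 i = false) : ∀ i : Fin n, m ≤ i.1 → y.1 i = false := by
  induction p with
  | nil => exact hx
  | @cons a b c h p ih =>
    obtain ⟨i, hi⟩ := exists_toggle_of_remove_adj h
    refine ih fun k hk => ?_
    by_cases him : m ≤ i.1
    · exact absurd (hJ i him) (exit_neighborCubes hx (hi ▸ b.2) him)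
    · rw [hi, toggle_of_ne _ (fun e : k = i => him (e ▸ hk)), hx k hk]

theorem le_edist_of_le_length {V : Type*} {G : SimpleGraph V} {u v : V} {L : ℕ∞}
    (h : ∀ p : G.Walk u v, L ≤ p.length) : L ≤ G.edist u v :=
  le_iInf h

theorem card_filter_le_fin (hmn : m ≤ n) :
    (Finset.univ.filter fun i : Fin n => m ≤ i.1).card = n - m := by
  have h := Finset.card_filter_add_card_filter_not (s := (Finset.univ : Finset (Fin n)))
    (fun i => i.1 < m)
  rw [Fin.card_filter_val_lt, Finset.card_univ, Fintype.card_fin, min_eq_right hmn] at h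
  simp only [not_lt] at h
  omega

end Extremal

/-! ### Connectivity and fault diameter. -/

section Main

variable {n m : ℕ}

theorem structureConnectivity_hypercube (hm : m + 2 ≤ n) :
    structureConnectivity (hypercube n) (hypercube m) = (n - m : ℕ) := by
  refine le_antisymm ?_ ?_
  · have hJ : ∀ i : Fin n, m ≤ i.1 → i ∈ Finset.univ.filter fun i : Fin n => m ≤ i.1 :=
      fun i hi => by simp [hi]
    have hdis : ¬ (remove (hypercube n) (neighborCubes m
        (Finset.univ.filter fun i : Fin n => m ≤ i.1))).Preconnected := by
      intro hconn
      have hu : (fun _ => false : Fin n → Bool) ∈ {x : Fin n → Bool | ∀ H ∈ neighborCubes m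
          (Finset.univ.filter fun i : Fin n => m ≤ i.1), x ∉ H.verts} := by
        rw [Set.mem_ofPred_eq, notMem_neighborCubes_iff]
        intro j hj h
        have := h j (Finset.mem_filter.1 hj).2
        simp at this
      have hv : (fun _ => true : Fin n → Bool) ∈ {x : Fin n → Bool | ∀ H ∈ neighborCubes m
          (Finset.univ.filter fun i : Fin n => m ≤ i.1), x ∉ H.verts} := by
        rw [Set.mem_ofPred_eq, notMem_neighborCubes_iff]
        intro j _ h
        -- The neighbouring cubes have exactly one `true` from position `m` on; the all-`true`
        -- string has at least two there, as `m + 2 ≤ n`.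
        have h1 := h ⟨n - 1, by omega⟩ (by simp only; omega)
        have h2 := h ⟨n - 2, by omega⟩ (by simp only; omega)
        simp only [true_eq_decide_iff] at h1 h2
        rw [← h2, Fin.mk.injEq] at h1
        omega
      obtain ⟨p⟩ := hconn ⟨_, hu⟩ ⟨_, hv⟩
      have := eq_false_of_walk hJ p (fun _ _ => rfl) ⟨n - 1, by omega⟩ (by simp only; omega)
      simp at this
    refine (iInf₂_le _ ⟨isStructureFamily_neighborCubes (by omega)
      (fun j hj => (Finset.mem_filter.1 hj).2), hdis⟩).trans ?_
    exact_mod_cast (card_neighborCubes_le _).trans (card_filter_le_fin (by omega)).le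
  · refine le_iInf₂ fun F hF => ?_
    by_contra! hlt
    have hcard : F.card < n - m := by exact_mod_cast hlt
    refine hF.2 fun u v => SimpleGraph.reachable_of_edist_ne_top fun htop => ?_
    have := edist_remove_le_succ hF.1 (by omega) u v
    rw [htop] at this
    exact absurd this (by simp)

theorem card_add_one_le_structureConnectivity (hm : m + 2 ≤ n)
    (F : Finset (hypercube n).Subgraph) :
    (F.card : ℕ∞) + 1 ≤ structureConnectivity (hypercube n) (hypercube m) ↔ F.card + m < n := by
  rw [structureConnectivity_hypercube hm, ← Nat.cast_one, ← Nat.cast_add, Nat.cast_le]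
  omega

theorem structureFaultDiameter_hypercube_add_two (hm : n = m + 2) :
    structureFaultDiameter (hypercube n) (hypercube m) = (n : ℕ∞) := by
  refine le_antisymm (iSup₂_le fun F hF => ?_) ?_
  · have := (card_add_one_le_structureConnectivity (by omega) F).1 hF.2
    exact SimpleGraph.ediam_le_of_edist_le
      (edist_remove_le_of_card_le_one hF.1 (by omega))
  · refine le_trans ?_ (le_iSup₂ (∅ : Finset (hypercube n).Subgraph)
      ⟨⟨by simp, by simp⟩, (card_add_one_le_structureConnectivity (by omega) ∅).2 (by simp; omega)⟩)
    refine le_trans (le_edist_of_le_length fun p => ?_) (SimpleGraph.edist_le_ediam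
      (u := ⟨fun _ => false, by simp⟩) (v := ⟨fun _ => true, by simp⟩))
    have := hammingDist_le_length p
    simp only [hammingDist, ne_eq, Bool.false_eq_true, not_false_eq_true, Finset.filter_true,
      Finset.card_univ, Fintype.card_fin] at this
    exact_mod_cast this

theorem structureFaultDiameter_hypercube_of_add_three_le (hm : m + 3 ≤ n) :
    structureFaultDiameter (hypercube n) (hypercube m) = (n : ℕ∞) + 1 := by
  refine le_antisymm (iSup₂_le fun F hF => ?_) ?_
  · have := (card_add_one_le_structureConnectivity (by omega) F).1 hF.2
    exact SimpleGraph.ediam_le_of_edist_le (edist_remove_le_succ hF.1 this)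
  · let j : Fin n := ⟨n - 1, by omega⟩
    set J : Finset (Fin n) := (Finset.univ.filter fun i : Fin n => m ≤ i.1).erase j with hJdef
    have hjm : m ≤ j.1 := by simp only [j]; omega
    have hJ : ∀ i : Fin n, m ≤ i.1 → i ≠ j → i ∈ J := fun i hi hij =>
      Finset.mem_erase.2 ⟨hij, Finset.mem_filter.2 ⟨Finset.mem_univ _, hi⟩⟩
    have hJm : ∀ i ∈ J, m ≤ i.1 := fun i hi =>
      (Finset.mem_filter.1 (Finset.mem_of_mem_erase hi)).2
    have hJc : J.card = n - m - 1 := by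
      rw [hJdef, Finset.card_erase_of_mem (by simpa using hjm),
        card_filter_le_fin (by omega)]
    have hcard := card_neighborCubes_le (m := m) J
    refine le_trans ?_ (le_iSup₂ (neighborCubes m J)
      ⟨isStructureFamily_neighborCubes (by omega) hJm,
        (card_add_one_le_structureConnectivity (by omega) _).2 (by omega)⟩)
    let x : Fin n → Bool := fun _ => false
    -- The target agrees with `x` only at `j`, the one open exit: distance `n - 1`, plus two for the
    -- detour.
    let y : Fin n → Bool := toggle (fun _ => true) j
    have hx : ∀ H ∈ neighborCubes m J, x ∉ H.verts := by
      rw [notMem_neighborCubes_iff]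
      intro i hi h
      have := h i (hJm i hi)
      simp [x] at this
    have hytrue : ∀ i : Fin n, i.1 < n - 1 → y i = true := fun i hi => by
      have : i ≠ j := fun e => by
        have : i.1 = n - 1 := by rw [e]
        omega
      simp [y, toggle_of_ne _ this]
    have hy : ∀ H ∈ neighborCubes m J, y ∉ H.verts := by
      rw [notMem_neighborCubes_iff]
      intro i _ h
      -- Here `m + 3 ≤ n` is needed: besides `j`, two positions from `m` on carry `true`, so `y`
      -- lies in no removed cube.
      have h1 := h ⟨n - 2, by omega⟩ (by simp only; omega)
      have h2 := h ⟨n - 3, by omega⟩ (by simp only; omega)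
      rw [hytrue _ (by simp only; omega)] at h1 h2
      simp only [true_eq_decide_iff] at h1 h2
      rw [← h2, Fin.mk.injEq] at h1
      omega
    refine le_trans (le_edist_of_le_length fun p => ?_) (SimpleGraph.edist_le_ediam
      (u := ⟨x, hx⟩) (v := ⟨y, hy⟩))
    have h1 := hammingDist_add_two_le_length hJ p (fun _ _ => rfl) (by simp [y])
      ⟨⟨n - 2, by omega⟩, by simp only; omega, hytrue _ (by simp only; omega)⟩
    have h2 : hammingDist x y + 1 = n := by
      have h3 : hammingDist y x + 1 = hammingDist (toggle y j) x :=
        (hammingDist_toggle_of_eq (by simp [x, y])).symm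
      rw [hammingDist_comm, h3]
      simp [x, y, hammingDist]
    have h4 : n + 1 ≤ p.length := by
      simp only at h1
      omega
    exact_mod_cast h4

end Main
end StructureFault

theorem theorem3p26 (n m : ℕ) (hn : 3 ≤ n) (hm : m + 2 ≤ n) :
    (n = m + 2 →
      StructureFault.structureFaultDiameter
        (StructureFault.hypercube n) (StructureFault.hypercube m) = (n : ℕ∞)) ∧
    (m + 3 ≤ n →
      StructureFault.structureFaultDiameter
        (StructureFault.hypercube n) (StructureFault.hypercube m) = (n : ℕ∞) + 1) :=
  ⟨StructureFault.structureFaultDiameter_hypercube_add_two,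
    StructureFault.structureFaultDiameter_hypercube_of_add_three_le⟩
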